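/- A \emph{clique matrix} of a finite graph $G$ is a $0$-$1$ matrix with one row for each vertex, one column for each maximal clique, and a $1$ in the row of $v$ and the column of $K$ exactly when $v\in K$. A graph is \emph{chordal} if it has no chordless cycle on four or more vertices. Write a row of a $0$-$1$ matrix as the set of columns in which it has a $1$, with columns numbered from $0$. The \emph{Tucker matrices} and their \emph{incomplete columns} are: - $M_I(k)$, $k\ge 3$ ($k\times k$): rows $\{i,i+1\}$ for $0\le i\le k-2$, and $\{0,k-1\}$. For $k=3$ all three columns are incomplete; for $k>3$ there are no incomplete columns. - $M_{II}(k)$, $k\ge 4$ ($k\times k$): rows $\{0,1,\dots,k-2\}$, $\{i,i+1\}$ for $1\le i\le k-2$, and $\{0\}\cup\{2,\dots,k-1\}$. Incomplete columns: $0,1,k-1$. - $M_{III}(k)$, $k\ge 3$ ($k\times(k+1)$): rows $\{i,i+1\}$ for $0\le i\le k-2$, and $\{1,\dots,k-2\}\cup\{k\}$. Incomplete columns: $0,k-1,k$. - $M_{IV}$ ($4\times 6$): rows $\{0,1\},\{2,3\},\{4,5\},\{1,3,5\}$. Incomplete columns: $0,2,4$. - $M_V$ ($4\times 5$): rows $\{0,1\},\{2,3\},\{0,1,2,3\},\{1,2,4\}$.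 Incomplete columns: $0,3,4$. An instance of a Tucker matrix in a matrix $M$ is a choice of distinct rows and distinct columns of $M$, each in some order, whose submatrix $M_T$ is that Tucker matrix. It \emph{can be completed using rows of $M$} if to each incomplete column $j$ of $M_T$ one can assign a row $x_j$ of $M$, not among the rows of $M_T$, that has a $1$ in column $j$ and in no other column of $M_T$. \textbf{Lemma.} Let $G$ be a finite chordal graph and let $M_T$ be an instance of a Tucker matrix in a clique matrix $M$ of $G$. Then $M_T$ can be completed using rows of $M$. -/

import Mathlib

namespace TuckerCompletion

/-- A graph is chordal if it has no chordless cycle on four or more vertices. -/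
def IsChordal {V : Type*} (G : SimpleGraph V) : Prop :=
  ∀ ⦃v : V⦄ (p : G.Walk v v), p.IsCycle → 4 ≤ p.length → ¬ p.IsChordless

/-- `M` is a clique matrix of `G`: its rows correspond bijectively to the vertices of `G`, its
columns correspond bijectively to the (inclusion-)maximal cliques of `G`, and an entry is `1`
exactly if the vertex of its row lies in the clique of its column. -/
def IsCliqueMatrix {V ρ κ : Type*} (G : SimpleGraph V) (M : Matrix ρ κ (Fin 2)) : Prop :=
  ∃ (e : ρ ≃ V) (f : κ ≃ {S : Set V // Maximal G.IsClique S}),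
    ∀ i j, M i j = 1 ↔ e i ∈ (f j : Set V)

/-- `M_I(k)`, `k ≥ 3`: row `i` is `{i, i + 1}` for `i < k - 1`, and the last row is
`{0, k - 1}`. -/
def matI (k : ℕ) : Matrix (Fin k) (Fin k) (Fin 2) :=
  Matrix.of fun i j => if j.val = i.val ∨ j.val = (i.val + 1) % k then 1 else 0

/-- `M_II(k)`, `k ≥ 4`: row `0` is `{0, 1, …, k - 2}`, row `i` is `{i, i + 1}` for
`1 ≤ i ≤ k - 2`, and row `k - 1` is `{0} ∪ {2, …, k - 1}`. -/
def matII (k : ℕ) : Matrix (Fin k) (Fin k) (Fin 2) :=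
  Matrix.of fun i j =>
    if i.val = 0 then (if j.val + 1 < k then 1 else 0)
    else if i.val + 1 < k then (if j.val = i.val ∨ j.val = i.val + 1 then 1 else 0)
    else (if j.val ≠ 1 then 1 else 0)

/-- `M_III(k)`, `k ≥ 3`, with columns `0, …, k`: row `i` is `{i, i + 1}` for `i ≤ k - 2`, and
row `k - 1` is `{1, …, k - 2} ∪ {k}`. -/
def matIII (k : ℕ) : Matrix (Fin k) (Fin (k + 1)) (Fin 2) :=
  Matrix.of fun i j =>
    if i.val + 1 < k then (if j.val = i.val ∨ j.val = i.val + 1 then 1 else 0)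
    else (if j.val ≠ 0 ∧ j.val ≠ k - 1 then 1 else 0)

/-- `M_IV`. -/
def matIV : Matrix (Fin 4) (Fin 6) (Fin 2) :=
  !![1, 1, 0, 0, 0, 0;
     0, 0, 1, 1, 0, 0;
     0, 0, 0, 0, 1, 1;
     0, 1, 0, 1, 0, 1]

/-- `M_V`. -/
def matV : Matrix (Fin 4) (Fin 5) (Fin 2) :=
  !![1, 1, 0, 0, 0;
     0, 0, 1, 1, 0;
     1, 1, 1, 1, 0;
     0, 1, 1, 0, 1]

/-- The types of Tucker matrices (the minimal forbidden submatrices for the consecutive-ones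
property). -/
inductive TuckerType
  | I (k : ℕ) (hk : 3 ≤ k)
  | II (k : ℕ) (hk : 4 ≤ k)
  | III (k : ℕ) (hk : 3 ≤ k)
  | IV
  | V

namespace TuckerType

/-- The number of rows of a Tucker matrix. -/
def numRows : TuckerType → ℕ
  | I k _ => k
  | II k _ => k
  | III k _ => k
  | IV => 4
  | V => 4

/-- The number of columns of a Tucker matrix. -/
def numCols : TuckerType → ℕ
  | I k _ => k
  | II k _ => k
  | III k _ => k + 1
  | IV => 6
  | V => 5

/-- The Tucker matrix of a given type. -/
def matrix : (T : TuckerType) → Matrix (Fin T.numRows) (Fin T.numCols) (Fin 2)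
  | I k _ => matI k
  | II k _ => matII k
  | III k _ => matIII k
  | IV => matIV
  | V => matV

/-- The incomplete columns of a Tucker matrix: the three columns such that adding, for each of
them, one row whose only `1` is in that column gives the clique matrix of a chordal
Lekkerkerker-Boland graph (for `M_I(3)`, whose completion is the clique matrix of the `3`-sun
without the column of the central triangle, these are all three columns). The matrices `M_I(k)`
with `k > 3`, which do not arise in this way from a chordal graph, have no incomplete columns. -/
def IsIncomplete : (T : TuckerType) → Fin T.numCols → Prop
  | I k _, _ => k = 3
  | II k _, j => j.val = 0 ∨ j.val = 1 ∨ j.val = k - 1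
  | III k _, j => j.val = 0 ∨ j.val = k - 1 ∨ j.val = k
  | IV, j => j.val = 0 ∨ j.val = 2 ∨ j.val = 4
  | V, j => j.val = 0 ∨ j.val = 3 ∨ j.val = 4

end TuckerType

/-- The instance of a Tucker matrix of type `T` that occupies the rows `r` and the columns `c` of
`M` can be completed using rows of `M`: to every incomplete column one can assign a further row of
`M`, not among the rows `r`, that has a `1` in that column and in no other of the columns `c`. -/
def CanBeCompleted {ρ κ : Type*} (M : Matrix ρ κ (Fin 2)) (T : TuckerType)
    (r : Fin T.numRows ↪ ρ) (c : Fin T.numCols ↪ κ) : Prop :=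
  ∃ x : {j : Fin T.numCols // T.IsIncomplete j} → ρ,
    (∀ j, x j ∉ Set.range r) ∧
    ∀ (j : {j : Fin T.numCols // T.IsIncomplete j}) (j' : Fin T.numCols),
      M (x j) (c j') = 1 ↔ j' = j.val

end TuckerCompletion

/-! Fix an incomplete column `j` and let `K` be its maximal clique. The other columns of the Tucker
matrix are linked by rows with a `0` in column `j` (`TuckerType.connectedAvoiding`), that is, by
vertices outside `K`. So what their cliques have outside `K` lies in one component of `G - K`. By
chordality some `x ∈ K` has no neighbour in that component (`exists_mem_forall_not_adj`). Each other
clique meets the component, so it cannot contain `x`, and the row of `x` completes column `j`.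

The vertex `x` comes from an extremal argument. Let `d` in the component have the most neighbours in
`K`. If `d` misses `y ∈ K` and `y` has neighbours in the component, a shortest walk from `d` to one
of them ends, by `IsShortestTo.adj_end`, at a vertex adjacent to `y` and to all neighbours of `d` in
`K`. -/

namespace TuckerCompletion

open SimpleGraph

variable {V : Type*} {G : SimpleGraph V}

/-! ### Walks outside a vertex set -/

/-- Two vertices are joined outside `K` if some walk between them avoids `K`. -/
def JoinedOutside (G : SimpleGraph V) (K : Set V) (a b : V) : Prop :=
  ∃ p : G.Walk a b, ∀ w ∈ p.support, w ∉ K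

lemma JoinedOutside.notMem_right {K : Set V} {a b : V} (h : JoinedOutside G K a b) : b ∉ K := by
  obtain ⟨p, hp⟩ := h
  exact hp _ p.end_mem_support

lemma JoinedOutside.refl {K : Set V} {a : V} (h : a ∉ K) : JoinedOutside G K a a :=
  ⟨.nil, by simpa using h⟩

lemma JoinedOutside.symm {K : Set V} {a b : V} (h : JoinedOutside G K a b) :
    JoinedOutside G K b a := by
  obtain ⟨p, hp⟩ := h
  exact ⟨p.reverse, by simpa using hp⟩

lemma JoinedOutside.trans {K : Set V} {a b c : V} (h : JoinedOutside G K a b)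
    (h' : JoinedOutside G K b c) : JoinedOutside G K a c := by
  obtain ⟨p, hp⟩ := h
  obtain ⟨q, hq⟩ := h'
  exact ⟨p.append q, fun w hw => ((Walk.mem_support_append_iff _ _).1 hw).elim (hp w) (hq w)⟩

/-- Two vertices of a clique outside `K` are joined outside `K`. -/
lemma JoinedOutside.of_isClique {K C : Set V} (hC : G.IsClique C) {a b : V} (ha : a ∈ C)
    (hb : b ∈ C) (haK : a ∉ K) (hbK : b ∉ K) : JoinedOutside G K a b := by
  rcases eq_or_ne a b with rfl | hab
  · exact .refl haK
  · refine ⟨(hC ha hb hab).toWalk, ?_⟩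
    simp only [Adj.toWalk, Walk.support_cons, Walk.support_nil]
    grind

/-- A walk outside `K` to a neighbour of `y`, shortest among those from its starting point. -/
def IsShortestTo (K : Set V) (y : V) {a b : V} (p : G.Walk a b) : Prop :=
  (∀ w ∈ p.support, w ∉ K) ∧ G.Adj y b ∧
    ∀ (b' : V) (q : G.Walk a b'), (∀ w ∈ q.support, w ∉ K) → G.Adj y b' → p.length ≤ q.length

lemma JoinedOutside.exists_isShortestTo {K : Set V} {a b y : V} (h : JoinedOutside G K a b)
    (hy : G.Adj y b) : ∃ (b' : V) (p : G.Walk a b'), IsShortestTo K y p := by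
  classical
  have hex : ∃ n, ∃ (b' : V) (p : G.Walk a b'), (∀ w ∈ p.support, w ∉ K) ∧ G.Adj y b' ∧
      p.length = n := by
    obtain ⟨p, hp⟩ := h
    exact ⟨_, b, p, hp, hy, rfl⟩
  obtain ⟨b', p, hp, hyb, hlen⟩ := Nat.find_spec hex
  refine ⟨b', p, hp, hyb, fun b'' q hq hyq => ?_⟩
  rw [hlen]
  exact Nat.find_min' hex ⟨b'', q, hq, hyq, rfl⟩

lemma IsShortestTo.of_cons {K : Set V} {y a a' b : V} {h : G.Adj a a'} {p : G.Walk a' b}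
    (hp : IsShortestTo K y (.cons h p)) : IsShortestTo K y p := by
  obtain ⟨h1, h2, h3⟩ := hp
  refine ⟨fun w hw => h1 w (by simp [hw]), h2, fun b' q hq hy => ?_⟩
  have := h3 b' (.cons h q) (by
    intro w hw
    rcases List.mem_cons.1 hw with rfl | hw
    · exact h1 _ (by simp)
    · exact hq w hw) hy
  simpa using this

lemma IsShortestTo.dropUntil_length [DecidableEq V] {K : Set V} {y a a' b w : V} {h : G.Adj a a'}
    {p : G.Walk a' b} (hp : IsShortestTo K y (.cons h p)) (hw : w ∈ p.support)
    (haw : G.Adj a w) : p.length ≤ (p.dropUntil w hw).length := by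
  obtain ⟨h1, h2, h3⟩ := hp
  have := h3 b (.cons haw (p.dropUntil w hw)) (by
    intro v hv
    rcases List.mem_cons.1 hv with rfl | hv
    · exact h1 _ (by simp)
    · exact h1 _ (by simp [p.support_dropUntil_subset_support hw hv])) h2
  simpa using this

lemma IsShortestTo.isPath {K : Set V} {y a b : V} {p : G.Walk a b} (hp : IsShortestTo K y p) :
    p.IsPath := by
  classical
  induction p with
  | nil => exact .nil
  | @cons a a' b h p ih =>
    refine (ih hp.of_cons).cons fun ha => ?_
    have h3 := hp.2.2 b (p.dropUntil a ha)
      (fun w hw => hp.1 w (by simp [p.support_dropUntil_subset_support ha hw])) hp.2.1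
    have := p.length_dropUntil_le_length ha
    simp at h3
    omega

/-- An edge from the first vertex to a later one is a shortcut unless it leads to the second vertex;
induction on the tail gives that there are no chords. -/
lemma IsShortestTo.mem_edges {K : Set V} {y a b u v : V} {p : G.Walk a b}
    (hp : IsShortestTo K y p) (hu : u ∈ p.support) (hv : v ∈ p.support) (huv : G.Adj u v) :
    s(u, v) ∈ p.edges := by
  classical
  induction p with
  | nil =>
    simp only [Walk.support_nil, List.mem_singleton] at hu hv
    exact absurd (hu.trans hv.symm) huv.ne
  | @cons a a' b h p ih =>
    have key : ∀ w ∈ p.support, G.Adj a w → w = a' := by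
      intro w hw haw
      have h1 := hp.dropUntil_length hw haw
      have h2 := congrArg Walk.length (p.take_spec hw)
      rw [Walk.length_append] at h2
      have h3 : (p.takeUntil w hw).length = 0 := by omega
      exact (Walk.eq_of_length_eq_zero h3).symm
    simp only [Walk.support_cons, List.mem_cons, Walk.edges_cons] at hu hv ⊢
    rcases hu with rfl | hu <;> rcases hv with rfl | hv
    · exact absurd rfl huv.ne
    · left; rw [key v hv huv]
    · left; rw [key u hu huv.symm, Sym2.eq_swap]
    · right; exact ih hp.of_cons hu hv

lemma IsShortestTo.eq_of_adj {K : Set V} {y a b w : V} {p : G.Walk a b}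
    (hp : IsShortestTo K y p) (hw : w ∈ p.support) (hyw : G.Adj y w) : w = b := by
  induction p with
  | nil => simpa using hw
  | @cons a a' b h p ih =>
    rcases List.mem_cons.1 hw with hwa | hw
    · have := hp.2.2 a .nil (by simpa using hp.1 a (by simp)) (hwa ▸ hyw)
      simp at this
    · exact ih hp.of_cons hw

/-! ### Chordality and components outside a maximal clique -/

/-- In a chordal graph, a neighbour `z ∈ K` of `y ∈ K` that is adjacent to some vertex of a
shortest walk outside `K` to the neighbourhood of `y` is adjacent to the last vertex. -/
lemma IsShortestTo.adj_end (hG : IsChordal G) {K : Set V} {y z a b : V} (hy : y ∈ K) (hz : z ∈ K)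
    (hyz : G.Adj y z) {p : G.Walk a b} (hp : IsShortestTo K y p)
    (hw : ∃ w ∈ p.support, G.Adj z w) : G.Adj z b := by
  induction p with
  | nil =>
    obtain ⟨w, hw, hzw⟩ := hw
    simp only [Walk.support_nil, List.mem_singleton] at hw
    exact hw ▸ hzw
  | @cons a a' b h p ih =>
    -- If `z` has a neighbour further along, the first vertex can be dropped. Otherwise `a` is its
    -- only neighbour on the walk, and `y, z, a, …, b, y` will be a chordless cycle of length at
    -- least 4.
    by_cases hex : ∃ w ∈ p.support, G.Adj z w
    · exact ih hp.of_cons hex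
    exfalso
    push Not at hex
    obtain ⟨w, hw, hzw⟩ := hw
    have hza : G.Adj z a := by
      rcases List.mem_cons.1 hw with hw | hw
      · exact hw ▸ hzw
      · exact absurd hzw (hex w hw)
    clear hw hzw w
    have hyb := hp.2.1
    obtain ⟨q, hqdef⟩ : ∃ q : G.Walk a y, q = (Walk.cons h p).concat hyb.symm := ⟨_, rfl⟩
    have hysup : y ∉ (Walk.cons h p).support := fun hm => hp.1 y hm hy
    have hzsup : z ∉ (Walk.cons h p).support := fun hm => hp.1 z hm hz
    have hqs : ∀ v, v ∈ q.support ↔ v ∈ (Walk.cons h p).support ∨ v = y := by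
      intro v
      simp [hqdef, Walk.support_concat, or_assoc]
    have hqe : ∀ e, e ∈ q.edges ↔ e ∈ (Walk.cons h p).edges ∨ e = s(b, y) := by
      intro e
      simp [hqdef, Walk.edges_concat, or_assoc]
    have hq : q.IsPath := hqdef ▸ hp.isPath.concat hysup hyb.symm
    have hzq : z ∉ q.support := by
      rw [hqs]
      rintro (hm | rfl)
      · exact hzsup hm
      · exact hyz.ne rfl
    have hcyc : (Walk.cons hyz (Walk.cons hza q)).IsCycle := by
      rw [Walk.cons_isCycle_iff]
      refine ⟨hq.cons hzq, ?_⟩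
      rw [Walk.edges_cons, List.mem_cons]
      rintro (he | he)
      · rcases Sym2.eq_iff.1 he with ⟨h1, -⟩ | ⟨h1, -⟩
        · exact hyz.ne h1
        · rw [h1] at hysup
          exact hysup (Walk.start_mem_support _)
      · exact hzq (q.snd_mem_support_of_mem_edges he)
    refine hG _ hcyc (by simp [hqdef]) ?_
    rw [Walk.isChordless_iff_forall_mem_edges]
    have hP : ∀ v ∈ (Walk.cons h p).support, G.Adj z v → v = a := by
      intro v hv hzv
      rcases List.mem_cons.1 hv with hv | hv
      · exact hv
      · exact absurd hzv (hex v hv)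
    have hY : ∀ v ∈ (Walk.cons h p).support, G.Adj y v → v = b := fun v hv => hp.eq_of_adj hv
    have hE : ∀ u ∈ (Walk.cons h p).support, ∀ v ∈ (Walk.cons h p).support, G.Adj u v →
      s(u, v) ∈ (Walk.cons h p).edges := fun u hu v hv => hp.mem_edges hu hv
    have hsupp : ∀ v, v ∈ (Walk.cons hyz (Walk.cons hza q)).support ↔
        v = y ∨ v = z ∨ v ∈ (Walk.cons h p).support := by
      intro v
      rw [Walk.support_cons, List.mem_cons, Walk.support_cons, List.mem_cons, hqs]
      tauto
    have hedge : ∀ e, e ∈ (Walk.cons hyz (Walk.cons hza q)).edges ↔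
        e = s(y, z) ∨ e = s(z, a) ∨ e ∈ (Walk.cons h p).edges ∨ e = s(b, y) := by
      intro e
      rw [Walk.edges_cons, List.mem_cons, Walk.edges_cons, List.mem_cons, hqe]
    intro u v hu hv huv
    rw [hsupp] at hu hv
    rw [hedge]
    rcases hu with rfl | rfl | hu <;> rcases hv with rfl | rfl | hv
    · exact absurd rfl huv.ne
    · exact .inl rfl
    · exact .inr (.inr (.inr (by rw [hY v hv huv, Sym2.eq_swap])))
    · exact .inl Sym2.eq_swap
    · exact absurd rfl huv.ne
    · exact .inr (.inl (by rw [hP v hv huv]))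
    · exact .inr (.inr (.inr (by rw [hY u hu huv.symm])))
    · exact .inr (.inl (by rw [hP u hu huv.symm, Sym2.eq_swap]))
    · exact .inr (.inr (.inl (hE u hu v hv huv)))

/-- In a finite chordal graph, every component of the complement of a maximal clique `K` has no
neighbour of some vertex of `K`. -/
lemma exists_mem_forall_not_adj [Finite V] (hG : IsChordal G) {K : Set V}
    (hK : Maximal G.IsClique K) (d₀ : V) :
    ∃ x ∈ K, ∀ b, JoinedOutside G K d₀ b → ¬ G.Adj x b := by
  by_contra! hcon
  -- `d₀` may itself lie in `K`, so nonemptiness has to come from `hcon`, or from `d₀` when `K` is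
  -- empty.
  have hd₀ : ∃ d, JoinedOutside G K d₀ d := by
    by_contra! hd
    have hne : K.Nonempty := by
      by_contra hK0
      rw [Set.not_nonempty_iff_eq_empty] at hK0
      exact hd d₀ (.refl (by simp [hK0]))
    obtain ⟨x, hx⟩ := hne
    obtain ⟨b, hb, -⟩ := hcon x hx
    exact hd b hb
  obtain ⟨d, hd, hmax⟩ := Set.exists_max_image {d | JoinedOutside G K d₀ d}
    (fun d => {z ∈ K | G.Adj z d}.ncard) (Set.toFinite _) hd₀
  by_cases hall : ∀ z ∈ K, G.Adj z d
  · have hins : G.IsClique (insert d K) :=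
      hK.prop.insert fun z hz _ => (hall z hz).symm
    exact hd.notMem_right (hK.le_of_ge hins (Set.subset_insert d K) (Set.mem_insert d K))
  · push Not at hall
    obtain ⟨y, hyK, hyd⟩ := hall
    obtain ⟨b, hb, hyb⟩ := hcon y hyK
    obtain ⟨b', p, hp⟩ := (hd.symm.trans hb).exists_isShortestTo hyb
    have hb' : JoinedOutside G K d₀ b' := hd.trans ⟨p, hp.1⟩
    refine absurd (hmax b' hb') (not_le.2 (Set.ncard_lt_ncard ?_ (Set.toFinite _)))
    rw [Set.ssubset_iff_of_subset]
    · exact ⟨y, ⟨hyK, hp.2.1⟩, fun h => hyd h.2⟩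
    · rintro z ⟨hz, hzd⟩
      have hyz : y ≠ z := fun h => hyd (h ▸ hzd)
      exact ⟨hz, hp.adj_end hG hyK hz (hK.prop hyK hz hyz) ⟨d, p.start_mem_support, hzd⟩⟩

/-! ### Connectedness of Tucker matrices off an incomplete column -/

lemma matI_apply_eq_one {k : ℕ} {i j : Fin k} :
    matI k i j = 1 ↔ j.val = i.val ∨ j.val = (i.val + 1) % k := by
  simp only [matI, Matrix.of_apply]
  split_ifs <;> grind

lemma matII_apply_eq_one {k : ℕ} {i j : Fin k} :
    matII k i j = 1 ↔ (i.val = 0 ∧ j.val + 1 < k) ∨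
      (i.val ≠ 0 ∧ i.val + 1 < k ∧ (j.val = i.val ∨ j.val = i.val + 1)) ∨
      (i.val ≠ 0 ∧ ¬ i.val + 1 < k ∧ j.val ≠ 1) := by
  simp only [matII, Matrix.of_apply]
  split_ifs <;> grind

lemma matIII_apply_eq_one {k : ℕ} {i : Fin k} {j : Fin (k + 1)} :
    matIII k i j = 1 ↔ (i.val + 1 < k ∧ (j.val = i.val ∨ j.val = i.val + 1)) ∨
      (¬ i.val + 1 < k ∧ j.val ≠ 0 ∧ j.val ≠ k - 1) := by
  simp only [matIII, Matrix.of_apply]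
  split_ifs <;> grind

/-- `P` holds throughout `[m, n]` if it holds at `m` and passes from each number to the next. -/
lemma forall_mem_Icc_of_step {P : ℕ → Prop} {m n : ℕ} (h0 : P m)
    (hs : ∀ i, m ≤ i → i < n → P i → P (i + 1)) (i : ℕ) (hm : m ≤ i) (hn : i ≤ n) : P i := by
  induction i, hm using Nat.le_induction with
  | base => exact h0
  | succ i hi ih => exact hs i hi (by omega) (ih (by omega))

/-- The columns other than `j` are connected by the rows of `A` with a `0` in column `j`. -/
def ConnectedAvoiding {m n : ℕ} (A : Matrix (Fin m) (Fin n) (Fin 2)) (j : Fin n) : Prop :=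
  ∃ j₀ ≠ j, ∀ Q : Fin n → Prop,
    (∀ i j₁ j₂, A i j ≠ 1 → A i j₁ = 1 → A i j₂ = 1 → Q j₁ → Q j₂) →
    Q j₀ → ∀ j', j' ≠ j → Q j'

lemma connectedAvoiding_matI_three (j : Fin 3) : ConnectedAvoiding (matI 3) j := by
  refine ⟨j + 1, by revert j; decide, fun Q hQ h0 j' hne => ?_⟩
  refine hQ (j + 1) (j + 1) j' ?_ ?_ ?_ h0 <;> clear hQ h0 Q <;> revert j j' <;> decide

/-- Off column 0 the rows `{i, i + 1}` form a chain; off columns 1 and `k - 1` a single row contains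
all other columns. -/
lemma connectedAvoiding_matII {k : ℕ} (hk : 4 ≤ k) (j : Fin k)
    (hj : j.val = 0 ∨ j.val = 1 ∨ j.val = k - 1) : ConnectedAvoiding (matII k) j := by
  simp only [ConnectedAvoiding, ne_eq, matII_apply_eq_one]
  simp only [Fin.ext_iff]
  rcases hj with hj | hj | hj
  · refine ⟨⟨1, by omega⟩, by dsimp only; omega, fun Q hQ h0 j' hne => ?_⟩
    have := forall_mem_Icc_of_step (P := fun n => ∀ h : n < k, Q ⟨n, h⟩) (m := 1) (n := k - 1)
      (fun _ => h0) (fun i hi hik hP h => hQ ⟨i, by omega⟩ ⟨i, by omega⟩ ⟨i + 1, h⟩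
        (by dsimp only; omega) (by dsimp only; omega) (by dsimp only; omega) (hP _))
    exact this j' (by omega) (by omega) j'.2
  · refine ⟨⟨0, by omega⟩, by dsimp only; omega, fun Q hQ h0 j' hne => ?_⟩
    exact hQ ⟨k - 1, by omega⟩ ⟨0, by omega⟩ j' (by dsimp only; omega) (by dsimp only; omega)
      (by dsimp only; omega) h0
  · refine ⟨⟨0, by omega⟩, by dsimp only; omega, fun Q hQ h0 j' hne => ?_⟩
    exact hQ ⟨0, by omega⟩ ⟨0, by omega⟩ j' (by dsimp only; omega) (by dsimp only; omega)
      (by dsimp only; omega) h0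

/-- The rows `{i, i + 1}` chain the columns below `k`, cut at either end if needed; column `k` is
attached to column 1 by the last row. -/
lemma connectedAvoiding_matIII {k : ℕ} (hk : 3 ≤ k) (j : Fin (k + 1))
    (hj : j.val = 0 ∨ j.val = k - 1 ∨ j.val = k) : ConnectedAvoiding (matIII k) j := by
  simp only [ConnectedAvoiding, ne_eq, matIII_apply_eq_one]
  simp only [Fin.ext_iff]
  rcases hj with hj | hj | hj
  · refine ⟨⟨1, by omega⟩, by dsimp only; omega, fun Q hQ h0 j' hne => ?_⟩
    have := forall_mem_Icc_of_step (P := fun n => ∀ h : n < k + 1, Q ⟨n, h⟩) (m := 1)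
      (n := k - 1) (fun _ => h0) (fun i hi hik hP h => hQ ⟨i, by omega⟩ ⟨i, by omega⟩ ⟨i + 1, h⟩
        (by dsimp only; omega) (by dsimp only; omega) (by dsimp only; omega) (hP _))
    by_cases hjk : j'.val = k
    · exact hQ ⟨k - 1, by omega⟩ ⟨1, by omega⟩ j' (by dsimp only; omega) (by dsimp only; omega)
        (by dsimp only; omega) h0
    · exact this j' (by omega) (by omega) j'.2
  · refine ⟨⟨0, by omega⟩, by dsimp only; omega, fun Q hQ h0 j' hne => ?_⟩
    have := forall_mem_Icc_of_step (P := fun n => ∀ h : n < k + 1, Q ⟨n, h⟩) (m := 0)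
      (n := k - 2) (fun _ => h0) (fun i hi hik hP h => hQ ⟨i, by omega⟩ ⟨i, by omega⟩ ⟨i + 1, h⟩
        (by dsimp only; omega) (by dsimp only; omega) (by dsimp only; omega) (hP _))
    by_cases hjk : j'.val = k
    · exact hQ ⟨k - 1, by omega⟩ ⟨1, by omega⟩ j' (by dsimp only; omega) (by dsimp only; omega)
        (by dsimp only; omega) (this 1 (by omega) (by omega) _)
    · exact this j' (by omega) (by omega) j'.2
  · refine ⟨⟨0, by omega⟩, by dsimp only; omega, fun Q hQ h0 j' hne => ?_⟩
    have := forall_mem_Icc_of_step (P := fun n => ∀ h : n < k + 1, Q ⟨n, h⟩) (m := 0)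
      (n := k - 1) (fun _ => h0) (fun i hi hik hP h => hQ ⟨i, by omega⟩ ⟨i, by omega⟩ ⟨i + 1, h⟩
        (by dsimp only; omega) (by dsimp only; omega) (by dsimp only; omega) (hP _))
    exact this j' (by omega) (by omega) j'.2

/-- Row `i` of `A` has a `1` in column `j`. -/
def HasOne {m n : ℕ} (A : Matrix (Fin m) (Fin n) (Fin 2)) (i : Fin m) (j : Fin n) : Prop :=
  A i j = 1

instance {m n : ℕ} (A : Matrix (Fin m) (Fin n) (Fin 2)) (i : Fin m) (j : Fin n) :
    Decidable (HasOne A i j) :=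
  inferInstanceAs (Decidable (A i j = 1))

/-- Connectedness, if one column can be joined to all others by at most two rows. -/
lemma ConnectedAvoiding.of_two_steps {m n : ℕ} {A : Matrix (Fin m) (Fin n) (Fin 2)} {j : Fin n}
    (h : ∃ j₀ ≠ j, ∀ j', j' ≠ j → ∃ i₁ i₂ j₁, ¬ HasOne A i₁ j ∧ ¬ HasOne A i₂ j ∧
      HasOne A i₁ j₀ ∧ HasOne A i₁ j₁ ∧ HasOne A i₂ j₁ ∧ HasOne A i₂ j') : ConnectedAvoiding A j := by
  obtain ⟨j₀, hj₀, h⟩ := h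
  refine ⟨j₀, hj₀, fun Q hQ h0 j' hne => ?_⟩
  obtain ⟨i₁, i₂, j₁, h1, h2, h3, h4, h5, h6⟩ := h j' hne
  exact hQ i₂ j₁ j' h2 h5 h6 (hQ i₁ j₀ j₁ h1 h3 h4 h0)

lemma connectedAvoiding_matIV (j : Fin 6) (hj : j.val = 0 ∨ j.val = 2 ∨ j.val = 4) :
    ConnectedAvoiding matIV j :=
  .of_two_steps (by revert j; decide)

lemma connectedAvoiding_matV (j : Fin 5) (hj : j.val = 0 ∨ j.val = 3 ∨ j.val = 4) :
    ConnectedAvoiding matV j :=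
  .of_two_steps (by revert j; decide)

/-- The columns other than an incomplete column `j` are connected by the rows with a `0` in
column `j`. -/
lemma TuckerType.connectedAvoiding (T : TuckerType) (j : Fin T.numCols) (hj : T.IsIncomplete j) :
    ConnectedAvoiding T.matrix j := by
  cases T with
  | I k hk =>
    obtain rfl : k = 3 := hj
    exact connectedAvoiding_matI_three j
  | II k hk => exact connectedAvoiding_matII hk j hj
  | III k hk => exact connectedAvoiding_matIII hk j hj
  | IV => exact connectedAvoiding_matIV j hj
  | V => exact connectedAvoiding_matV j hj

/-- Separates completing rows, which have a single `1` in the chosen columns, from the rows of the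
instance. -/
lemma TuckerType.exists_two_columns (T : TuckerType) (i : Fin T.numRows) :
    ∃ j₁ j₂, j₁ ≠ j₂ ∧ T.matrix i j₁ = 1 ∧ T.matrix i j₂ = 1 := by
  cases T with
  | I k hk =>
    change Fin k at i
    refine ⟨i, (⟨(i.val + 1) % k, Nat.mod_lt _ (by omega)⟩ : Fin k), fun h => ?_,
      matI_apply_eq_one.2 (.inl rfl), matI_apply_eq_one.2 (.inr rfl)⟩
    have h1 : i.val = (i.val + 1) % k := congrArg Fin.val h
    have hi := i.isLt
    change i.val < k at hi
    rcases Nat.lt_or_ge (i.val + 1) k with h2 | h2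
    · rw [Nat.mod_eq_of_lt h2] at h1
      omega
    · rw [show i.val + 1 = k by omega, Nat.mod_self] at h1
      omega
  | II k hk =>
    change Fin k at i
    have key : ∃ j₁ j₂ : Fin k, j₁ ≠ j₂ ∧ matII k i j₁ = 1 ∧ matII k i j₂ = 1 := by
      simp only [matII_apply_eq_one, ne_eq]
      simp only [Fin.ext_iff]
      by_cases h0 : i.val = 0
      · exact ⟨⟨0, by omega⟩, ⟨1, by omega⟩, by simp, by dsimp only; omega, by dsimp only; omega⟩
      by_cases h1 : i.val + 1 < k
      · exact ⟨i, ⟨i + 1, h1⟩, by simp, by omega, by dsimp only; omega⟩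
      · exact ⟨⟨0, by omega⟩, ⟨2, by omega⟩, by simp, by dsimp only; omega, by dsimp only; omega⟩
    exact key
  | III k hk =>
    change Fin k at i
    have key : ∃ j₁ j₂ : Fin (k + 1), j₁ ≠ j₂ ∧ matIII k i j₁ = 1 ∧ matIII k i j₂ = 1 := by
      simp only [matIII_apply_eq_one, ne_eq]
      simp only [Fin.ext_iff]
      by_cases h1 : i.val + 1 < k
      · exact ⟨⟨i, by omega⟩, ⟨i + 1, by omega⟩, by simp, by dsimp only; omega, by dsimp only; omega⟩
      · exact ⟨⟨1, by omega⟩, ⟨k, by omega⟩, by dsimp only; omega, by dsimp only; omega, by dsimp only; omega⟩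
    exact key
  | IV =>
    have key : ∀ i, ∃ j₁ j₂, j₁ ≠ j₂ ∧ HasOne matIV i j₁ ∧ HasOne matIV i j₂ := by decide
    exact key i
  | V =>
    have key : ∀ i, ∃ j₁ j₂, j₁ ≠ j₂ ∧ HasOne matV i j₁ ∧ HasOne matV i j₂ := by decide
    exact key i

end TuckerCompletion

/-! ### The completion -/

theorem mainTheorem5 {V ρ κ : Type*} [Finite V] (G : SimpleGraph V)
    (hG : TuckerCompletion.IsChordal G)
    (M : Matrix ρ κ (Fin 2)) (hM : TuckerCompletion.IsCliqueMatrix G M)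
    (T : TuckerCompletion.TuckerType)
    (r : Fin T.numRows ↪ ρ) (c : Fin T.numCols ↪ κ)
    (hT : M.submatrix r c = T.matrix) :
    TuckerCompletion.CanBeCompleted M T r c := by
  open TuckerCompletion in
  obtain ⟨e, f, hef⟩ := hM
  have hent : ∀ i j, T.matrix i j = 1 ↔ e (r i) ∈ (f (c j) : Set V) := by
    intro i j
    rw [← hT, ← hef]
    rfl
  have main : ∀ j : {j : Fin T.numCols // T.IsIncomplete j}, ∃ x : ρ,
      ∀ j' : Fin T.numCols, M x (c j') = 1 ↔ j' = j.val := by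
    rintro ⟨j, hj⟩
    set K : Set V := (f (c j) : Set V) with hKdef
    have hK : Maximal G.IsClique K := (f (c j)).2
    obtain ⟨j₀, hj₀, hconn⟩ := T.connectedAvoiding j hj
    -- Distinct maximal cliques are not nested.
    have hout : ∀ j', j' ≠ j → ∃ v ∈ (f (c j') : Set V), v ∉ K := by
      intro j' hne
      by_contra! hsub
      have h1 : (f (c j') : Set V) = K :=
        (f (c j')).2.eq_of_le hK.prop hsub
      exact hne (c.injective (f.injective (Subtype.ext h1)))
    obtain ⟨d₀, hd₀, hd₀K⟩ := hout j₀ hj₀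
    obtain ⟨x, hx, hadj⟩ := exists_mem_forall_not_adj hG hK d₀
    have hjoin := hconn (fun j' => ∀ v ∈ (f (c j') : Set V), v ∉ K → JoinedOutside G K d₀ v)
      (by
        intro i j₁ j₂ h0 h1 h2 hQ v hv hvK
        have h0K := (hent i j).not.1 h0
        exact (hQ _ ((hent i j₁).1 h1) h0K).trans
          (.of_isClique (f (c j₂)).2.prop ((hent i j₂).1 h2) hv h0K hvK))
      (fun v hv hvK => .of_isClique (f (c j₀)).2.prop hd₀ hv hd₀K hvK)
    refine ⟨e.symm x, fun j' => ?_⟩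
    rw [hef, Equiv.apply_symm_apply]
    refine ⟨fun hxj => ?_, ?_⟩
    · by_contra hne
      obtain ⟨v, hv, hvK⟩ := hout j' hne
      -- A clique containing `x` would make `x` adjacent to its vertex `v` in the component.
      exact hadj v (hjoin j' hne v hv hvK)
        ((f (c j')).2.prop hxj hv fun h => hvK (h ▸ hx))
    · rintro rfl
      exact hx
  choose x hx using main
  refine ⟨x, ?_, hx⟩
  rintro j ⟨i, hi⟩
  obtain ⟨j₁, j₂, hne, h1, h2⟩ := T.exists_two_columns i
  rw [← hT, Matrix.submatrix_apply, hi, hx] at h1 h2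
  exact hne (h1.trans h2.symm)
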